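/- **Theorem 1.4.** Let $F$ be a field, let $b_1,\ldots,b_n\in F$ and $c_{ij}\in F$ for $1\le i<j\le n$. Let $m,k$ be integers with $m>0$ and $k>m(n-1)$, let $P_1(x),\ldots,P_n(x)\in F[x]$ be monic of degree $m$, and let $A_1,\ldots,A_n$ be subsets of $F$ with $|A_1|=\cdots=|A_n|=k$. Put $$L=(k-1)n-(m+1)\binom n2,\qquad B=(b_j^{\,i-1})_{1\le i,j\le n},$$ where $b^0=1$ for every $b\in F$, including $b=0$, and $$C=\Big\{\sum_{i=1}^n a_i:\ a_i\in A_i\ (1\le i\le n),\ \ P_i(a_i)\ne P_j(a_j)\ \text{and}\ a_ib_i-a_jb_j\ne c_{ij}\ \text{for all}\ i<j\Big\}.$$ Let $\mathrm{ch}(F)$ be the additive order of the identity of $F$ (so $\mathrm{ch}(F)=\infty$ if the characteristic is zero in the usual sense), and let $\mathrm{per}(B)=\sum_{\sigma\in S_n}\prod_{i=1}^n b_{\sigma(i)}^{\,i-1}$ be the permanent of $B$. (i) If $\mathrm{ch}(F)>L$ and $\mathrm{per}(B)\ne0$, then $|C|>L\ge(m-1)\binom n2$. (ii) If $\mathrm{ch}(F)=2$,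 $m=1$, $k=n+1$ and $b_1,\ldots,b_n$ are pairwise distinct, then $|C|\ge n+1$. (iii) Suppose that $F=\mathbb C$ and that $b_1,\ldots,b_n$ are $q$-th roots of unity, where $q$ is a positive integer. Let $D(q)$ be the set of all sums $\sum_{p\mid q}p\,x_p$ over the prime divisors $p$ of $q$, with nonnegative integers $x_p$. If $n!\notin D(q)$, or if $q$ is odd and $b_1,\ldots,b_n$ are pairwise distinct, then $|C|\ge L+1$. -/

import Mathlib

open Polynomial

namespace SunSumset

/-- The characteristic of a field `F` as the additive order of the identity `1`, with the
value `⊤` (infinity) when `1` has infinite additive order. -/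
noncomputable def ch (F : Type*) [Field F] : WithTop ℤ :=
  if addOrderOf (1 : F) = 0 then ⊤ else ((addOrderOf (1 : F) : ℤ) : WithTop ℤ)

/-- The matrix `(b_j ^ (i - 1))` with `1 ≤ i, j ≤ n`; the indices here start from `0`. -/
def powMatrix {F : Type*} [Field F] {n : ℕ} (b : Fin n → F) : Matrix (Fin n) (Fin n) F :=
  Matrix.of fun i j => b j ^ (i : ℕ)

/-- The set of sums `a_1 + ⋯ + a_n` with `a_i ∈ A_i` for all `i`, and with
`P_i(a_i) ≠ P_j(a_j)` and `a_i b_i - a_j b_j ≠ c_ij` whenever `i < j`.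
Only the values `c i j` with `i < j` matter. -/
def restrictedSums {F : Type*} [Field F] {n : ℕ} (A : Fin n → Finset F) (P : Fin n → F[X])
    (b : Fin n → F) (c : Fin n → Fin n → F) : Set F :=
  {s | ∃ a : Fin n → F, (∀ i, a i ∈ A i) ∧
    (∀ i j, i < j → (P i).eval (a i) ≠ (P j).eval (a j) ∧ a i * b i - a j * b j ≠ c i j) ∧
    s = ∑ i, a i}

/-- The set of all sums `∑ p x_p` over the primes `p` dividing `q`, with nonnegative
integers `x_p`. -/
def D (q : ℕ) : Set ℕ :=
  {s | ∃ x : ℕ → ℕ, s = ∑ p ∈ q.primeFactors, p * x p}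

/-- The integer `(k - 1) n - (m + 1) * (n choose 2)`. -/
def L (k m n : ℕ) : ℤ := ((k : ℤ) - 1) * n - ((m : ℤ) + 1) * (n.choose 2 : ℤ)

end SunSumset

namespace SunSumset

/-! Suppose the set T of sums has at most ℓ = L elements, and write S = x_1 + ⋯ + x_n and K = k - 1.
The polynomial ∏_{s ∈ T} (S - s) · S^(ℓ - |T|) · ∏_{i<j} (P_i(x_i) - P_j(x_j)) (b_i x_i - b_j x_j -
c_ij) vanishes on A_1 × ⋯ × A_n and has degree at most nK, so the Combinatorial Nullstellensatz
forces its coefficient at ∏ x_i^K to vanish (`lt_ncard_restrictedSums`). Only the top form matters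
there, and expanding its two Vandermonde products gives Z · per(B), where Z is
`alternatingMultinomial n m K` (`coeff_sum_pow_mul_prod`). It remains to see that Z and per(B) are
nonzero in F.

Up to factorials, Z is a determinant of descending factorials, hence a Vandermonde determinant: |Z|
= ℓ! ∏_{i<j} m(j - i) / ∏_i (K - m i)!, with indices from 0. So Z divides ℓ!, which is invertible
when ch(F) > L, and Z = ±1 when m = 1 and K = n, which survives in characteristic 2.

In characteristic 2 the permanent is itself a Vandermonde determinant. For distinct roots of unity
of odd order, reduction modulo a maximal ideal above 2 leads back to that case. Otherwise per(B) is
a sum of n! q-th roots of unity, and by Lam–Leung (`card_mem_D_of_sum_eq_zero`) it can vanish only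
if n! ∈ D(q). -/

open Finset Equiv

/-! ### Evaluation of the alternating multinomial sum -/

/-- The coefficient of `x ^ (K - e)` in `(x_1 + ⋯ + x_n) ^ ℓ`, where `ℓ = ∑ (K - e_i)`. -/
def complMultinomial {n : ℕ} (K : ℕ) (e : Fin n → ℕ) : ℕ :=
  if ∀ i, e i ≤ K then Nat.multinomial univ (fun i => K - e i) else 0

theorem complMultinomial_comp_perm {n : ℕ} (K : ℕ) (e : Fin n → ℕ) (τ : Perm (Fin n)) :
    complMultinomial K (fun i => e (τ i)) = complMultinomial K e := by
  unfold complMultinomial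
  have h : (∀ i, e (τ i) ≤ K) ↔ ∀ i, e i ≤ K := τ.forall_congr fun i => Iff.rfl
  simp only [h, Nat.multinomial]
  rw [Equiv.sum_comp τ (fun i => K - e i), Equiv.prod_comp τ (fun i => (K - e i).factorial)]

theorem factorial_pow_mul_complMultinomial {n K ℓ : ℕ} (e : Fin n → ℕ)
    (h : ℓ + ∑ i, e i = n * K) :
    K.factorial ^ n * complMultinomial K e = ℓ.factorial * ∏ i, K.descFactorial (e i) := by
  unfold complMultinomial
  split_ifs with he
  · have hs : ∑ i, (K - e i) = ℓ := by
      have : ∑ i, (K - e i) + ∑ i, e i = n * K := by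
        rw [← sum_add_distrib]
        simp [Nat.sub_add_cancel (he _)]
      omega
    have hp : K.factorial ^ n = (∏ i, (K - e i).factorial) * ∏ i, K.descFactorial (e i) := by
      rw [← prod_mul_distrib]
      simp [Nat.factorial_mul_descFactorial (he _)]
    have := Nat.multinomial_spec univ (fun i => K - e i)
    rw [hs] at this
    rw [hp, ← this]
    ring
  -- The default value 0 agrees with the descending factorial, which vanishes when some `e i`
  -- exceeds `K`.
  · push Not at he
    obtain ⟨i, hi⟩ := he
    rw [mul_zero, prod_eq_zero (mem_univ i) (Nat.descFactorial_of_lt hi), mul_zero]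

/-- The alternating sum of multinomial coefficients by which the permanent is multiplied in
`coeff_sum_pow_mul_prod`. -/
def alternatingMultinomial (n m K : ℕ) : ℤ :=
  ∑ ρ : Perm (Fin n), (Perm.sign ρ : ℤ) * complMultinomial K (fun i => m * (ρ i : ℕ) + (i : ℕ))

theorem sum_perm_exponent (n m : ℕ) (σ τ : Perm (Fin n)) :
    ∑ i, (m * (σ i : ℕ) + (τ i : ℕ)) = (m + 1) * n.choose 2 := by
  rw [sum_add_distrib, ← mul_sum, Equiv.sum_comp σ (fun i : Fin n => (i : ℕ)),
    Equiv.sum_comp τ (fun i : Fin n => (i : ℕ)), Fin.sum_univ_eq_sum_range (fun i => i),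
    sum_range_id, Nat.choose_two_right]
  ring

/-- After scaling by K!^n the sum is the determinant of the descending factorials of K of order mj +
i. Each splits as the one of order mj, constant along a row, times the one of K - mj of order i, a
monic polynomial of degree i in K - mj; what remains is a Vandermonde determinant in the numbers K -
mj. -/
theorem prod_factorial_mul_alternatingMultinomial {n m K ℓ : ℕ}
    (hK : ∀ i : Fin n, m * (i : ℕ) ≤ K) (h : ℓ + (m + 1) * n.choose 2 = n * K) :
    (∏ i : Fin n, ((K - m * (i : ℕ)).factorial : ℤ)) * alternatingMultinomial n m K =
      ℓ.factorial * ∏ i : Fin n, ∏ j ∈ Ioi i, ((m * (i : ℕ) : ℤ) - m * (j : ℕ)) := by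
  have h1 : (K.factorial : ℤ) ^ n * alternatingMultinomial n m K = ℓ.factorial *
      (Matrix.of fun j i : Fin n => (K.descFactorial (m * (j : ℕ) + (i : ℕ)) : ℤ)).det := by
    rw [alternatingMultinomial, Matrix.det_apply', mul_sum, mul_sum]
    refine sum_congr rfl fun ρ _ => ?_
    have := factorial_pow_mul_complMultinomial (K := K) (ℓ := ℓ)
      (fun i => m * (ρ i : ℕ) + (i : ℕ)) (by
        rw [← h, ← sum_perm_exponent n m ρ 1]; simp)
    have h2 : (K.factorial : ℤ) ^ n *
        complMultinomial K (fun i => m * (ρ i : ℕ) + (i : ℕ)) =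
        ℓ.factorial * ∏ i, (K.descFactorial (m * (ρ i : ℕ) + (i : ℕ)) : ℤ) := by
      exact_mod_cast this
    simp only [Matrix.of_apply]
    linear_combination (Perm.sign ρ : ℤ) * h2
  have h2 : (Matrix.of fun j i : Fin n => (K.descFactorial (m * (j : ℕ) + (i : ℕ)) : ℤ)).det =
      (∏ j : Fin n, (K.descFactorial (m * (j : ℕ)) : ℤ)) *
        ∏ i : Fin n, ∏ j ∈ Ioi i, ((m * (i : ℕ) : ℤ) - m * (j : ℕ)) := by
    have h3 := Matrix.det_eval_matrixOfPolynomials_eq_det_vandermonde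
      (fun j : Fin n => ((K - m * (j : ℕ) : ℕ) : ℤ)) (fun i => descPochhammer ℤ i)
      (fun i => descPochhammer_natDegree _ _) (fun i => monic_descPochhammer _ _)
    simp only [descPochhammer_eval_eq_descFactorial] at h3
    have h4 : ∀ i j : Fin n, (((K - m * (j : ℕ) : ℕ) : ℤ) - ((K - m * (i : ℕ) : ℕ) : ℤ)) =
        m * (i : ℕ) - m * (j : ℕ) := by
      intro i j
      rw [Nat.cast_sub (hK i), Nat.cast_sub (hK j)]
      push_cast
      ring
    rw [Matrix.det_vandermonde] at h3
    simp only [h4] at h3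
    rw [h3, ← Matrix.det_mul_column]
    congr 1
    ext j i
    simp only [Matrix.of_apply]
    have := Nat.descFactorial_mul_descFactorial (n := K)
      (Nat.le_add_right (m * (j : ℕ)) (i : ℕ))
    rw [Nat.add_sub_cancel_left] at this
    rw [← this]
    push_cast
    ring
  have h5 : (K.factorial : ℤ) ^ n = (∏ i : Fin n, ((K - m * (i : ℕ)).factorial : ℤ)) *
      ∏ j : Fin n, (K.descFactorial (m * (j : ℕ)) : ℤ) := by
    rw [← prod_mul_distrib]
    have : ∀ i : Fin n, ((K - m * (i : ℕ)).factorial : ℤ) * (K.descFactorial (m * (i : ℕ)) : ℤ)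
        = K.factorial := fun i => by exact_mod_cast Nat.factorial_mul_descFactorial (hK i)
    simp [this]
  have h6 : (∏ j : Fin n, (K.descFactorial (m * (j : ℕ)) : ℤ)) ≠ 0 :=
    prod_ne_zero_iff.2 fun j _ => by
      exact_mod_cast (Nat.descFactorial_pos.2 (hK j)).ne'
  rw [h5, h2] at h1
  apply mul_left_cancel₀ h6
  linear_combination h1

theorem prod_Icc_one_id (n : ℕ) : ∏ x ∈ Icc 1 n, x = n.factorial := by
  induction n with
  | zero => rfl
  | succ n ih => rw [prod_Icc_succ_top (by omega), ih, Nat.factorial_succ, mul_comm]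

/-- The factors are distinct positive integers, none larger than K - m i. -/
theorem prod_Ioi_dvd_factorial {n m K : ℕ} (hm : 0 < m) (hK : m * (n - 1) ≤ K) (i : Fin n) :
    ∏ j ∈ Ioi i, (m * ((j : ℕ) - (i : ℕ))) ∣ (K - m * (i : ℕ)).factorial := by
  rw [← prod_Icc_one_id]
  have hinj : Set.InjOn (fun j : Fin n => m * ((j : ℕ) - (i : ℕ))) (Ioi i : Finset (Fin n)) := by
    intro a ha b hb hab
    simp only [coe_Ioi, Set.mem_Ioi, Fin.lt_def] at ha hb
    have := Nat.eq_of_mul_eq_mul_left hm hab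
    exact Fin.ext (by omega)
  rw [← prod_image (f := fun x => x) hinj]
  refine prod_dvd_prod_of_subset _ _ _ fun x hx => ?_
  obtain ⟨j, hj, rfl⟩ := mem_image.1 hx
  simp only [mem_Ioi, Fin.lt_def] at hj
  rw [mem_Icc]
  refine ⟨Nat.mul_pos hm (by omega), ?_⟩
  have h1 : m * (j : ℕ) ≤ m * (n - 1) := Nat.mul_le_mul_left _ (by omega)
  rw [Nat.mul_sub]
  omega

theorem abs_prod_Ioi_sub {n m : ℕ} :
    |∏ i : Fin n, ∏ j ∈ Ioi i, ((m * (i : ℕ) : ℤ) - m * (j : ℕ))| =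
      ((∏ i : Fin n, ∏ j ∈ Ioi i, (m * ((j : ℕ) - (i : ℕ))) : ℕ) : ℤ) := by
  rw [abs_prod, Nat.cast_prod]
  refine prod_congr rfl fun i _ => ?_
  rw [abs_prod, Nat.cast_prod]
  refine prod_congr rfl fun j hj => ?_
  rw [mem_Ioi, Fin.lt_def] at hj
  rw [← mul_sub, abs_mul, Nat.abs_cast, Nat.cast_mul, Nat.cast_sub hj.le, abs_sub_comm,
    abs_of_nonneg (sub_nonneg.2 (by exact_mod_cast hj.le))]

theorem alternatingMultinomial_abs {n m K ℓ : ℕ} (hK : m * (n - 1) ≤ K)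
    (h : ℓ + (m + 1) * n.choose 2 = n * K) :
    (∏ i : Fin n, (K - m * (i : ℕ)).factorial) * (alternatingMultinomial n m K).natAbs =
      ℓ.factorial * ∏ i : Fin n, ∏ j ∈ Ioi i, (m * ((j : ℕ) - (i : ℕ))) := by
  have hK' : ∀ i : Fin n, m * (i : ℕ) ≤ K := fun i =>
    (Nat.mul_le_mul_left _ (by omega)).trans hK
  have := congrArg abs (prod_factorial_mul_alternatingMultinomial hK' h)
  rw [abs_mul, abs_mul, abs_prod_Ioi_sub, Nat.abs_cast, abs_prod] at this
  simp only [Nat.abs_cast] at this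
  rw [← Int.natCast_natAbs] at this
  exact_mod_cast this

theorem prod_Ioi_pos {n m : ℕ} (hm : 0 < m) :
    0 < ∏ i : Fin n, ∏ j ∈ Ioi i, (m * ((j : ℕ) - (i : ℕ))) :=
  prod_pos fun i _ => prod_pos fun j hj => by
    rw [mem_Ioi, Fin.lt_def] at hj
    exact Nat.mul_pos hm (by omega)

theorem alternatingMultinomial_dvd {n m K ℓ : ℕ} (hm : 0 < m) (hK : m * (n - 1) ≤ K)
    (h : ℓ + (m + 1) * n.choose 2 = n * K) :
    alternatingMultinomial n m K ∣ (ℓ.factorial : ℤ) := by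
  obtain ⟨M, hM⟩ := prod_dvd_prod_of_dvd (s := univ) _ _
    fun (i : Fin n) _ => prod_Ioi_dvd_factorial hm hK i
  have := alternatingMultinomial_abs hK h
  rw [hM] at this
  rw [← Int.natAbs_dvd, Int.natCast_dvd_natCast]
  refine ⟨M, Nat.eq_of_mul_eq_mul_left (prod_Ioi_pos (n := n) hm) ?_⟩
  linarith

theorem prod_Ioi_sub_eq_factorial {n : ℕ} (i : Fin n) :
    ∏ j ∈ Ioi i, (1 * ((j : ℕ) - (i : ℕ))) = (n - 1 - i).factorial := by
  rw [← prod_Icc_one_id]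
  refine prod_bij (fun j _ => (j : ℕ) - (i : ℕ)) ?_ ?_ ?_ ?_
  · intro j hj
    rw [mem_Ioi, Fin.lt_def] at hj
    rw [mem_Icc]
    omega
  · intro a ha b hb hab
    rw [mem_Ioi, Fin.lt_def] at ha hb
    exact Fin.ext (by omega)
  · intro x hx
    rw [mem_Icc] at hx
    exact ⟨⟨x + i, by omega⟩, by rw [mem_Ioi, Fin.lt_def]; simp; omega, by simp⟩
  · simp

theorem add_two_mul_choose_two (n : ℕ) : n + (1 + 1) * n.choose 2 = n * n := by
  rw [Nat.choose_two_right, one_add_one_eq_two,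
    Nat.mul_div_cancel' (Nat.even_mul_pred_self n).two_dvd]
  cases n with
  | zero => rfl
  | succ n => rw [Nat.add_sub_cancel]; ring

theorem alternatingMultinomial_natAbs_one (n : ℕ) :
    (alternatingMultinomial n 1 n).natAbs = 1 := by
  have := alternatingMultinomial_abs (n := n) (m := 1) (K := n) (ℓ := n) (by omega)
    (add_two_mul_choose_two n)
  simp only [prod_Ioi_sub_eq_factorial] at this
  have h3 : ∏ i : Fin n, (n - 1 * (i : ℕ)).factorial =
      n.factorial * ∏ i : Fin n, (n - 1 - (i : ℕ)).factorial := by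
    have h4 : ∏ i : Fin n, (n - (i : ℕ)) = n.factorial := by
      rw [Fin.prod_univ_eq_prod_range (fun i => n - i), ← Nat.descFactorial_self,
        Nat.descFactorial_eq_prod_range]
    rw [← h4, ← prod_mul_distrib]
    refine prod_congr rfl fun i _ => ?_
    have : n - 1 - (i : ℕ) + 1 = n - i := by omega
    rw [one_mul, ← this, Nat.factorial_succ]
  rw [h3] at this
  have hpos : 0 < n.factorial * ∏ i : Fin n, (n - 1 - (i : ℕ)).factorial :=
    Nat.mul_pos n.factorial_pos (prod_pos fun i _ => Nat.factorial_pos _)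
  exact Nat.eq_of_mul_eq_mul_left hpos (by rw [this, mul_one])

/-! ### The critical coefficient -/

theorem prod_Ioi_sub_eq_sum_perm {R : Type*} [CommRing R] {n : ℕ} (v : Fin n → R) :
    ∏ i : Fin n, ∏ j ∈ Ioi i, (v j - v i) =
      ∑ σ : Perm (Fin n), ((Perm.sign σ : ℤ) : R) * ∏ i, v i ^ (σ i : ℕ) := by
  rw [← Matrix.det_vandermonde, ← Matrix.det_transpose, Matrix.det_apply']
  rfl

theorem coeff_sum_pow_mul_monomial {F : Type*} [Field F] {n K ℓ : ℕ} (e : Fin n → ℕ) (r : F)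
    (h : ℓ + ∑ i, e i = n * K) :
    MvPolynomial.coeff (Finsupp.equivFunOnFinite.symm fun _ => K)
      ((∑ i, MvPolynomial.X i : MvPolynomial (Fin n) F) ^ ℓ *
        MvPolynomial.monomial (Finsupp.equivFunOnFinite.symm e) r) =
      (complMultinomial K e : F) * r := by
  have hle : Finsupp.equivFunOnFinite.symm e ≤ Finsupp.equivFunOnFinite.symm (fun _ => K) ↔
      ∀ i, e i ≤ K := Iff.rfl
  rw [MvPolynomial.coeff_mul_monomial', complMultinomial]
  simp only [hle]
  split_ifs with he
  · congr 1
    rw [MvPolynomial.coeff_sum_X_pow_of_fintype, if_pos, Finsupp.multinomial_eq_of_support_subset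
      (subset_univ _)]
    · rfl
    · rw [Finsupp.sum_fintype _ _ (fun _ => rfl)]
      have h1 : ∑ i, (K - e i) + ∑ i, e i = n * K := by
        rw [← sum_add_distrib]
        simp [Nat.sub_add_cancel (he _)]
      have h2 : ∑ i, (K - e i) = ℓ := by omega
      exact h2
  · simp

/-- Both products over i < j are Vandermonde determinants. Relative to the permutation τ of the
linear one, the other is ρτ: the signs combine to sgn ρ, and the multinomial coefficient, being
symmetric, does not depend on τ. The double sum therefore factors, and the sum over τ, having lost
its sign, is a permanent. -/
theorem coeff_sum_pow_mul_prod {F : Type*} [Field F] {n m K ℓ : ℕ} (b : Fin n → F)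
    (h : ℓ + (m + 1) * n.choose 2 = n * K) :
    MvPolynomial.coeff (Finsupp.equivFunOnFinite.symm fun _ => K)
      ((∑ i, MvPolynomial.X i : MvPolynomial (Fin n) F) ^ ℓ *
        ∏ i : Fin n, ∏ j ∈ Ioi i, ((MvPolynomial.X i ^ m - MvPolynomial.X j ^ m) *
          (MvPolynomial.C (b i) * MvPolynomial.X i - MvPolynomial.C (b j) * MvPolynomial.X j))) =
      (alternatingMultinomial n m K : F) * (powMatrix b).permanent := by
  have h1 : ∏ i : Fin n, ∏ j ∈ Ioi i,
      (((MvPolynomial.X i : MvPolynomial (Fin n) F) ^ m - MvPolynomial.X j ^ m) *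
        (MvPolynomial.C (b i) * MvPolynomial.X i - MvPolynomial.C (b j) * MvPolynomial.X j)) =
      ∑ τ : Perm (Fin n), ∑ ρ : Perm (Fin n), MvPolynomial.monomial
        (Finsupp.equivFunOnFinite.symm fun i => m * (ρ (τ i) : ℕ) + (τ i : ℕ))
        (((Perm.sign ρ : ℤ) : F) * ∏ i, b i ^ (τ i : ℕ)) := by
    have h2 : ∀ i j : Fin n, ((MvPolynomial.X i : MvPolynomial (Fin n) F) ^ m -
        MvPolynomial.X j ^ m) *
        (MvPolynomial.C (b i) * MvPolynomial.X i - MvPolynomial.C (b j) * MvPolynomial.X j) =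
        (MvPolynomial.X j ^ m - MvPolynomial.X i ^ m) *
        (MvPolynomial.C (b j) * MvPolynomial.X j - MvPolynomial.C (b i) * MvPolynomial.X i) :=
      fun i j => by ring
    rw [prod_congr rfl fun i _ => prod_congr rfl fun j _ => h2 i j]
    simp only [prod_mul_distrib]
    rw [prod_Ioi_sub_eq_sum_perm (fun i => (MvPolynomial.X i : MvPolynomial (Fin n) F) ^ m),
      prod_Ioi_sub_eq_sum_perm (fun i => MvPolynomial.C (b i) * MvPolynomial.X i), mul_comm,
      sum_mul_sum]
    refine sum_congr rfl fun τ _ => ?_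
    rw [← Equiv.sum_comp (Equiv.mulRight τ)]
    refine sum_congr rfl fun ρ _ => ?_
    rw [MvPolynomial.monomial_eq, Finsupp.prod_fintype _ _ (by simp)]
    have hs : ((Perm.sign τ : ℤ) : F) * ((Perm.sign τ : ℤ) : F) = 1 := by
      rw [← Int.cast_mul, ← Units.val_mul, Int.units_mul_self, Units.val_one, Int.cast_one]
    have hs' : (((Perm.sign τ : ℤ) : MvPolynomial (Fin n) F)) *
        ((Perm.sign τ : ℤ) : MvPolynomial (Fin n) F) = 1 := by
      rw [← Int.cast_mul, ← Units.val_mul, Int.units_mul_self, Units.val_one, Int.cast_one]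
    simp only [Equiv.coe_mulRight, Units.val_mul, Int.cast_mul, Perm.mul_apply,
      Finsupp.equivFunOnFinite_symm_apply_apply, mul_pow, pow_add, pow_mul, prod_mul_distrib,
      map_mul, map_prod, map_pow, map_intCast]
    linear_combination (((Perm.sign ρ : ℤ) : MvPolynomial (Fin n) F) *
      (∏ i, MvPolynomial.C (b i) ^ (τ i : ℕ)) * (∏ i, MvPolynomial.X i ^ (τ i : ℕ)) *
      ∏ i, (MvPolynomial.X i ^ m) ^ (ρ (τ i) : ℕ)) * hs'
  rw [h1, mul_sum, MvPolynomial.coeff_sum, Matrix.permanent, mul_sum]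
  refine sum_congr rfl fun τ _ => ?_
  rw [mul_sum, MvPolynomial.coeff_sum, alternatingMultinomial, Int.cast_sum, sum_mul]
  refine sum_congr rfl fun ρ _ => ?_
  rw [coeff_sum_pow_mul_monomial _ _ (by
    rw [← h, ← sum_perm_exponent n m (ρ * τ) τ]; rfl),
    complMultinomial_comp_perm K (fun i => m * (ρ i : ℕ) + (i : ℕ)) τ]
  simp only [powMatrix, Matrix.of_apply]
  push_cast
  ring

/-! ### Top-degree forms -/

section TopForm

open MvPolynomial

variable {σ R : Type*} [CommRing R]

/-- The polynomials all of whose monomials have degree less than `d`. -/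
def degreeLT (σ R : Type*) [CommRing R] (d : ℕ) : Submodule R (MvPolynomial σ R) where
  carrier := {f | ∀ e, MvPolynomial.coeff e f ≠ 0 → e.degree < d}
  add_mem' {f g} hf hg e he := by
    by_cases h : MvPolynomial.coeff e f = 0
    · refine hg e fun h' => he ?_
      rw [MvPolynomial.coeff_add, h, h', add_zero]
    · exact hf e h
  zero_mem' e he := absurd (MvPolynomial.coeff_zero e) he
  smul_mem' c f hf e he := hf e fun h => he (by rw [MvPolynomial.coeff_smul, h, smul_zero])

theorem degreeLT_mono {d d' : ℕ} (h : d ≤ d') : degreeLT σ R d ≤ degreeLT σ R d' :=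
  fun _ hf e he => (hf e he).trans_le h

theorem mul_mem_degreeLT {d d' : ℕ} {f g : MvPolynomial σ R} (hf : f ∈ degreeLT σ R d)
    (hg : g ∈ degreeLT σ R (d' + 1)) : f * g ∈ degreeLT σ R (d + d') := by
  classical
  intro e he
  rw [MvPolynomial.coeff_mul] at he
  obtain ⟨x, hx, hne⟩ := exists_ne_zero_of_sum_ne_zero he
  rw [Finset.HasAntidiagonal.mem_antidiagonal] at hx
  have h1 := hf _ (left_ne_zero_of_mul hne)
  have h2 := hg _ (right_ne_zero_of_mul hne)
  rw [← hx, map_add]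
  omega

theorem isHomogeneous_mem_degreeLT {d : ℕ} {g : MvPolynomial σ R} (hg : g.IsHomogeneous d) :
    g ∈ degreeLT σ R (d + 1) := by
  intro e he
  have := hg he
  rw [Finsupp.degree_eq_weight_one]
  exact Nat.lt_succ_of_le this.le

/-- `g` is homogeneous of degree `d`, and `f - g` only has monomials of degree less than `d`. -/
def HasTopForm (f g : MvPolynomial σ R) (d : ℕ) : Prop :=
  g.IsHomogeneous d ∧ f - g ∈ degreeLT σ R d

theorem HasTopForm.mul {f g f' g' : MvPolynomial σ R} {d d' : ℕ} (h : HasTopForm f g d)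
    (h' : HasTopForm f' g' d') : HasTopForm (f * f') (g * g') (d + d') := by
  refine ⟨h.1.mul h'.1, ?_⟩
  have : f * f' - g * g' = (f - g) * (f' - g') + (f - g) * g' + (f' - g') * g := by ring
  rw [this]
  refine add_mem (add_mem ?_ ?_) ?_
  · exact mul_mem_degreeLT h.2 (degreeLT_mono (Nat.le_succ _) h'.2)
  · exact mul_mem_degreeLT h.2 (isHomogeneous_mem_degreeLT h'.1)
  · rw [add_comm]
    exact mul_mem_degreeLT h'.2 (isHomogeneous_mem_degreeLT h.1)

theorem HasTopForm.prod {ι : Type*} (s : Finset ι) {f g : ι → MvPolynomial σ R} {d : ι → ℕ}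
    (h : ∀ i ∈ s, HasTopForm (f i) (g i) (d i)) :
    HasTopForm (∏ i ∈ s, f i) (∏ i ∈ s, g i) (∑ i ∈ s, d i) := by
  classical
  induction s using Finset.induction_on with
  | empty => exact ⟨isHomogeneous_one σ R, by simp⟩
  | insert a s ha ih =>
    rw [prod_insert ha, prod_insert ha, sum_insert ha]
    exact (h a (mem_insert_self a s)).mul (ih fun i hi => h i (mem_insert_of_mem hi))

theorem HasTopForm.sub {f g f' g' : MvPolynomial σ R} {d : ℕ} (h : HasTopForm f g d)
    (h' : HasTopForm f' g' d) : HasTopForm (f - f') (g - g') d := by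
  refine ⟨h.1.sub h'.1, ?_⟩
  rw [sub_sub_sub_comm]
  exact sub_mem h.2 h'.2

theorem C_mem_degreeLT (c : R) {d : ℕ} (hd : 0 < d) : MvPolynomial.C c ∈ degreeLT σ R d := by
  refine degreeLT_mono hd ?_
  simpa using isHomogeneous_mem_degreeLT (isHomogeneous_C σ c)

theorem HasTopForm.sub_C {f g : MvPolynomial σ R} {d : ℕ} (h : HasTopForm f g d) (hd : 0 < d)
    (c : R) : HasTopForm (f - MvPolynomial.C c) g d := by
  refine ⟨h.1, ?_⟩
  rw [sub_right_comm]
  exact sub_mem h.2 (C_mem_degreeLT c hd)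

theorem hasTopForm_self {g : MvPolynomial σ R} {d : ℕ} (h : g.IsHomogeneous d) :
    HasTopForm g g d := ⟨h, by simp⟩

theorem hasTopForm_aeval_X {P : R[X]} (hP : P.Monic) (i : σ) :
    HasTopForm (Polynomial.aeval (X i : MvPolynomial σ R) P) (X i ^ P.natDegree) P.natDegree := by
  refine ⟨isHomogeneous_X_pow i _, ?_⟩
  have h : Polynomial.aeval (X i : MvPolynomial σ R) P - X i ^ P.natDegree =
      ∑ s ∈ range P.natDegree, Polynomial.aeval (X i : MvPolynomial σ R)
        (Polynomial.C (P.coeff s) * Polynomial.X ^ s) := by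
    conv_lhs => enter [1]; rw [hP.as_sum]
    rw [map_add, map_pow, Polynomial.aeval_X, add_sub_cancel_left, map_sum]
  rw [h]
  refine sum_mem fun s hs => ?_
  rw [map_mul, Polynomial.aeval_C, map_pow, Polynomial.aeval_X, ← Algebra.smul_def]
  refine Submodule.smul_mem _ _ (degreeLT_mono (mem_range.1 hs) ?_)
  exact isHomogeneous_mem_degreeLT (isHomogeneous_X_pow i s)

theorem HasTopForm.coeff_eq {f g : MvPolynomial σ R} {d : ℕ} (h : HasTopForm f g d)
    {e : σ →₀ ℕ} (he : e.degree = d) : MvPolynomial.coeff e f = MvPolynomial.coeff e g := by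
  by_contra hne
  exact (h.2 e (by rwa [MvPolynomial.coeff_sub, sub_ne_zero])).ne he

theorem HasTopForm.totalDegree_eq {f g : MvPolynomial σ R} {d : ℕ} (h : HasTopForm f g d)
    {e : σ →₀ ℕ} (he : e.degree = d) (hne : MvPolynomial.coeff e f ≠ 0) :
    f.totalDegree = e.degree := by
  refine le_antisymm ?_ ?_
  · refine Finset.sup_le fun x hx => ?_
    change x.degree ≤ _
    by_cases hg : MvPolynomial.coeff x g = 0
    · rw [he]
      exact (h.2 x (by
        rwa [MvPolynomial.coeff_sub, hg, sub_zero, ← MvPolynomial.mem_support_iff])).le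
    · rw [he, ← h.1 hg, Finsupp.degree_eq_weight_one]
      exact le_rfl
  · exact le_totalDegree (mem_support_iff.2 hne)

end TopForm

/-! ### The polynomial method -/

theorem restrictedSums_finite {F : Type*} [Field F] {n : ℕ} (A : Fin n → Finset F)
    (P : Fin n → F[X]) (b : Fin n → F) (c : Fin n → Fin n → F) :
    (restrictedSums A P b c).Finite := by
  classical
  refine ((Fintype.piFinset A).image fun a => ∑ i, a i).finite_toSet.subset ?_
  rintro s ⟨a, ha, -, rfl⟩
  simp only [coe_image, Set.mem_image, mem_coe, Fintype.mem_piFinset]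
  exact ⟨a, ha, rfl⟩

theorem lt_ncard_restrictedSums {F : Type*} [Field F] {n m K ℓ : ℕ} 
    (h : ℓ + (m + 1) * n.choose 2 = n * K) (b : Fin n → F) (c : Fin n → Fin n → F)
    (P : Fin n → F[X]) (A : Fin n → Finset F) (hP : ∀ i, (P i).Monic)
    (hPm : ∀ i, (P i).natDegree = m) (hA : ∀ i, K < (A i).card)
    (hZ : (alternatingMultinomial n m K : F) ≠ 0) (hper : (powMatrix b).permanent ≠ 0) :
    ℓ < (restrictedSums A P b c).ncard := by
  by_contra! hle
  have hfin := restrictedSums_finite A P b c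
  rw [Set.ncard_eq_toFinset_card _ hfin] at hle
  set T := hfin.toFinset with hT
  let S : MvPolynomial (Fin n) F := ∑ i, MvPolynomial.X i
  have hS : S.IsHomogeneous 1 :=
    MvPolynomial.IsHomogeneous.sum _ _ _ fun i _ => MvPolynomial.isHomogeneous_X F i
  -- The power of `S` pads the degree to exactly n * K, whatever the size of `T`.
  let f : MvPolynomial (Fin n) F := (∏ s ∈ T, (S - MvPolynomial.C s)) * S ^ (ℓ - T.card) *
    ∏ i : Fin n, ∏ j ∈ Ioi i,
      ((Polynomial.aeval (MvPolynomial.X i) (P i) - Polynomial.aeval (MvPolynomial.X j) (P j)) *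
        (MvPolynomial.C (b i) * MvPolynomial.X i - MvPolynomial.C (b j) * MvPolynomial.X j -
          MvPolynomial.C (c i j)))
  let g : MvPolynomial (Fin n) F := S ^ ℓ * ∏ i : Fin n, ∏ j ∈ Ioi i,
      ((MvPolynomial.X i ^ m - MvPolynomial.X j ^ m) *
        (MvPolynomial.C (b i) * MvPolynomial.X i - MvPolynomial.C (b j) * MvPolynomial.X j))
  let t : Fin n →₀ ℕ := Finsupp.equivFunOnFinite.symm fun _ => K
  have ht : t.degree = n * K := by
    rw [Finsupp.degree_eq_sum]
    simp [t]
  have hfg : HasTopForm f g (n * K) := by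
    have h1 : HasTopForm (∏ s ∈ T, (S - MvPolynomial.C s)) (∏ s ∈ T, S) (∑ s ∈ T, 1) :=
      HasTopForm.prod T fun s _ => (hasTopForm_self hS).sub_C one_pos s
    have h2 : HasTopForm (S ^ (ℓ - T.card)) (S ^ (ℓ - T.card)) (1 * (ℓ - T.card)) :=
      hasTopForm_self (hS.pow _)
    have hlin : ∀ i, (MvPolynomial.C (b i) * MvPolynomial.X i :
        MvPolynomial (Fin n) F).IsHomogeneous 1 := fun i => by
      simpa using (MvPolynomial.isHomogeneous_C (Fin n) (b i)).mul
        (MvPolynomial.isHomogeneous_X F i)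
    have h3 := HasTopForm.prod univ fun (i : Fin n) _ => HasTopForm.prod (Ioi i) fun j _ =>
      ((hasTopForm_aeval_X (hP i) i).sub (by
        rw [hPm i, ← hPm j]; exact hasTopForm_aeval_X (hP j) j)).mul
      ((hasTopForm_self ((hlin i).sub (hlin j))).sub_C one_pos (c i j))
    have h4 := (h1.mul h2).mul h3
    have hdeg : ∑ s ∈ T, 1 + 1 * (ℓ - T.card) +
        ∑ i : Fin n, ∑ j ∈ Ioi i, ((P i).natDegree + 1) = n * K := by
      simp only [hPm, sum_const, smul_eq_mul, mul_one, one_mul, Fin.card_Ioi]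
      rw [← sum_mul, Fin.sum_univ_eq_sum_range (fun i => n - 1 - i), sum_range_reflect (fun i => i),
        sum_range_id, ← Nat.choose_two_right, mul_comm, ← h]
      omega
    rw [hdeg] at h4
    convert h4 using 1
    simp only [g, hPm, prod_const]
    rw [← pow_add]
    congr 2
    omega
  have hcoeff : MvPolynomial.coeff t f ≠ 0 := by
    rw [hfg.coeff_eq ht]
    have := coeff_sum_pow_mul_prod b h
    rw [show MvPolynomial.coeff t g = _ from this]
    exact mul_ne_zero hZ hper
  obtain ⟨a, haA, ha⟩ := MvPolynomial.combinatorial_nullstellensatz_exists_eval_nonzero f t hcoeff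
    (hfg.totalDegree_eq ht hcoeff) A hA
  refine ha ?_
  have heval : ∀ i, MvPolynomial.eval a (Polynomial.aeval (MvPolynomial.X i) (P i)) =
      (P i).eval (a i) := fun i => by
    rw [Polynomial.aeval_def, Polynomial.hom_eval₂]
    have : (MvPolynomial.eval a).comp (algebraMap F (MvPolynomial (Fin n) F)) = RingHom.id F := by
      ext x
      simp
    rw [this, MvPolynomial.eval_X, Polynomial.eval₂_id]
  have ha' : MvPolynomial.eval a f = (∏ s ∈ T, (∑ i, a i - s)) * (∑ i, a i) ^ (ℓ - T.card) *
    ∏ i : Fin n, ∏ j ∈ Ioi i, (((P i).eval (a i) - (P j).eval (a j)) *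
      (b i * a i - b j * a j - c i j)) := by
    simp only [f, S, map_mul, map_prod, map_sub, map_pow, map_sum, heval, MvPolynomial.eval_X,
      MvPolynomial.eval_C]
  rw [ha'] at ha ⊢
  have hprod := right_ne_zero_of_mul ha
  have hmem : ∑ i, a i ∈ T := by
    rw [hT, Set.Finite.mem_toFinset]
    refine ⟨a, haA, fun i j hij => ?_, rfl⟩
    have := prod_ne_zero_iff.1 (prod_ne_zero_iff.1 hprod i (mem_univ i)) j (mem_Ioi.2 hij)
    refine ⟨sub_ne_zero.1 (left_ne_zero_of_mul this), fun h0 => right_ne_zero_of_mul this ?_⟩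
    rw [← h0]
    ring
  rw [prod_eq_zero hmem (sub_self _), zero_mul, zero_mul]

/-! ### Arithmetic of L and of the characteristic -/

theorem le_L {n m k : ℕ} (hk : (m : ℤ) * ((n : ℤ) - 1) < k) :
    ((m : ℤ) - 1) * n.choose 2 ≤ L k m n := by
  have hc : (n.choose 2 : ℤ) * 2 = n * (n - 1) := by
    rcases n with _ | n
    · simp
    · have : (n + 1).choose 2 * 2 = (n + 1) * n := by
        rw [Nat.choose_two_right, Nat.div_mul_cancel (Nat.even_mul_pred_self _).two_dvd,
          Nat.add_sub_cancel]
      push_cast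
      rw [add_sub_cancel_right]
      exact_mod_cast this
  have h1 : (n : ℤ) * (m * (n - 1)) ≤ n * (k - 1) :=
    mul_le_mul_of_nonneg_left (by omega) (Nat.cast_nonneg n)
  unfold L
  linear_combination h1 + (m : ℤ) * hc

theorem L_nonneg {n m k : ℕ} (hm : 0 < m) (hk : (m : ℤ) * ((n : ℤ) - 1) < k) : 0 ≤ L k m n :=
  (mul_nonneg (by omega) (Nat.cast_nonneg _)).trans (le_L hk)

theorem toNat_L_add {n m k : ℕ} (hm : 0 < m) (hk : (m : ℤ) * ((n : ℤ) - 1) < k) :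
    (L k m n).toNat + (m + 1) * n.choose 2 = n * (k - 1) := by
  zify
  rw [Int.toNat_of_nonneg (L_nonneg hm hk), L]
  -- For n = 0 the bound allows k = 0, where `k - 1` is truncated.
  rcases Nat.eq_zero_or_pos n with rfl | hn
  · simp
  · have : 1 ≤ k := by
      have : (0 : ℤ) ≤ m * (n - 1) := mul_nonneg (Nat.cast_nonneg m) (by omega)
      omega
    push_cast [this]
    ring

theorem mul_pred_le {n m k : ℕ} (hk : (m : ℤ) * ((n : ℤ) - 1) < k) : m * (n - 1) ≤ k - 1 := by
  rcases Nat.eq_zero_or_pos n with rfl | hn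
  · simp
  · have : m * (n - 1) < k := by
      zify [hn]
      exact hk
    omega

theorem L_lt_ncard_restrictedSums {F : Type*} [Field F] {n m k : ℕ} (hm : 0 < m)
    (hk : (m : ℤ) * ((n : ℤ) - 1) < k) (b : Fin n → F) (c : Fin n → Fin n → F)
    (P : Fin n → F[X]) (A : Fin n → Finset F) (hP : ∀ i, (P i).Monic)
    (hPm : ∀ i, (P i).natDegree = m) (hA : ∀ i, (A i).card = k)
    (hZ : (alternatingMultinomial n m (k - 1) : F) ≠ 0) (hper : (powMatrix b).permanent ≠ 0) :
    L k m n < (restrictedSums A P b c).ncard := by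
  rw [← Int.toNat_of_nonneg (L_nonneg hm hk), Nat.cast_lt]
  refine lt_ncard_restrictedSums (K := k - 1) (toNat_L_add hm hk) b c P A hP hPm (fun i => ?_)
    hZ hper
  have : (m : ℤ) * (n - 1) ≥ 0 := mul_nonneg (Nat.cast_nonneg m) (by have := i.2; omega)
  rw [hA i]
  omega

theorem alternatingMultinomial_ne_zero {F : Type*} [Field F] {n m k : ℕ} (hm : 0 < m)
    (hk : (m : ℤ) * ((n : ℤ) - 1) < k) (hL : ((L k m n).toNat.factorial : F) ≠ 0) :
    (alternatingMultinomial n m (k - 1) : F) ≠ 0 := by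
  obtain ⟨M, hM⟩ := alternatingMultinomial_dvd hm (mul_pred_le hk) (toNat_L_add hm hk)
  intro h0
  apply hL
  rw [← Int.cast_natCast, hM, Int.cast_mul, h0, zero_mul]

theorem factorial_ne_zero_of_lt_ch {F : Type*} [Field F] {l : ℤ}
    (h : (l : WithTop ℤ) < ch F) : (l.toNat.factorial : F) ≠ 0 := by
  rw [Ne, CharP.cast_eq_zero_iff F (ringChar F)]
  unfold ch at h
  rw [CharP.eq F (CharP.addOrderOf_one F) (ringChar.charP F)] at h
  intro hdvd
  rcases CharP.char_is_prime_or_zero F (ringChar F) with hp | hp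
  · rw [if_neg hp.ne_zero, WithTop.coe_lt_coe] at h
    have := (hp.dvd_factorial).1 hdvd
    have := hp.pos
    omega
  · rw [hp, zero_dvd_iff] at hdvd
    exact Nat.factorial_ne_zero _ hdvd

theorem charP_two_of_ch_eq_two {F : Type*} [Field F] (h : ch F = 2) : CharP F 2 := by
  unfold ch at h
  split_ifs at h with h0
  · exact absurd h (by decide)
  · have : ((addOrderOf (1 : F) : ℤ)) = 2 :=
      WithTop.coe_injective (h.trans rfl)
    have : addOrderOf (1 : F) = 2 := by exact_mod_cast this
    rw [← this]
    exact CharP.addOrderOf_one F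

/-! ### Nonvanishing permanents via characteristic 2 -/

theorem permanent_ne_zero_of_charP_two {F : Type*} [Field F] [CharP F 2] {n : ℕ} {b : Fin n → F}
    (hb : Function.Injective b) : (powMatrix b).permanent ≠ 0 := by
  have h : (powMatrix b).permanent = (Matrix.vandermonde b).det := by
    rw [← Matrix.det_transpose, Matrix.permanent, Matrix.det_apply']
    refine sum_congr rfl fun σ _ => ?_
    have : ((Perm.sign σ : ℤ) : F) = 1 := by
      rcases Int.units_eq_one_or (Perm.sign σ) with h | h <;> simp [h, CharTwo.neg_eq]
    rw [this, one_mul]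
    rfl
  rw [h]
  exact Matrix.det_vandermonde_ne_zero_iff.2 hb

/-- Modulo a maximal ideal containing 2 of the ring of algebraic integers, the permanent becomes a
Vandermonde determinant. Since q is odd, X^q - 1 stays separable there and distinct roots stay
distinct. -/
theorem permanent_ne_zero_of_odd {q n : ℕ} (hq : Odd q) {b : Fin n → ℂ}
    (hb : ∀ i, b i ^ q = 1) (hinj : Function.Injective b) : (powMatrix b).permanent ≠ 0 := by
  let O := integralClosure ℤ ℂ
  have hq0 : 0 < q := hq.pos
  have h2 : ¬ IsUnit (2 : O) := by
    intro hu
    obtain ⟨x, hx⟩ := hu.exists_right_inv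
    have hx' : (2 : ℂ) * x = 1 := congrArg (fun y : O => (y : ℂ)) hx
    have hint : IsIntegral ℤ (algebraMap ℚ ℂ (1 / 2)) := by
      have : algebraMap ℚ ℂ (1 / 2) = x := by
        rw [map_div₀, map_one, map_ofNat]
        rw [div_eq_iff two_ne_zero, mul_comm, hx']
      rw [this]
      exact x.2
    rw [isIntegral_algebraMap_iff (algebraMap ℚ ℂ).injective] at hint
    obtain ⟨y, hy⟩ := IsIntegrallyClosed.isIntegral_iff.1 hint
    have h3 : ((2 * y : ℤ) : ℚ) = 1 := by
      push_cast
      rw [show (y : ℚ) = 1 / 2 from hy]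
      norm_num
    have h4 : 2 * y = 1 := by exact_mod_cast h3
    omega
  obtain ⟨I, hI, h2I⟩ := exists_max_ideal_of_mem_nonunits (mem_nonunits_iff.2 h2)
  let _ := Ideal.Quotient.field I
  let π : O →+* O ⧸ I := Ideal.Quotient.mk I
  have hπ2 : (2 : O ⧸ I) = 0 := by
    have := Ideal.Quotient.eq_zero_iff_mem.2 h2I
    rwa [map_ofNat] at this
  have : CharP (O ⧸ I) 2 := CharTwo.of_one_ne_zero_of_two_eq_zero one_ne_zero hπ2
  let β : Fin n → O := fun i => ⟨b i, IsIntegral.of_pow hq0 (by rw [hb i]; exact isIntegral_one)⟩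
  have hβ : ∀ i, β i ^ q = 1 := fun i => Subtype.ext (hb i)
  have hβinj : Function.Injective fun i => π (β i) := by
    intro i j hij
    by_contra hne
    have hsub : β i - β j ≠ 0 := sub_ne_zero.2 fun h =>
      hne (hinj (congrArg Subtype.val h))
    -- If β_i and β_j had the same residue, this cofactor of β_i - β_j in β_i^q - β_j^q would reduce
    -- to q β_j^(q-1), nonzero for odd q.
    have hgeom : ∑ t ∈ range q, β i ^ t * β j ^ (q - 1 - t) = 0 := by
      have := (Commute.all (β i) (β j)).geom_sum₂_mul q
      rw [hβ, hβ, sub_self] at this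
      exact (mul_eq_zero.1 this).resolve_right hsub
    have := congrArg π hgeom
    simp only [map_sum, map_mul, map_pow, map_zero] at this hij
    rw [hij] at this
    have hterm : ∀ t ∈ range q, π (β j) ^ t * π (β j) ^ (q - 1 - t) = π (β j) ^ (q - 1) := by
      intro t ht
      rw [← pow_add]
      congr 1
      rw [mem_range] at ht
      omega
    rw [sum_congr rfl hterm, sum_const, card_range, nsmul_eq_mul] at this
    have hne0 : π (β j) ≠ 0 := by
      intro h0
      have := congrArg π (hβ j)
      rw [map_pow, h0, zero_pow hq0.ne', map_one] at this
      exact zero_ne_one this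
    have hq' : (q : O ⧸ I) = 0 := (mul_eq_zero.1 this).resolve_right (pow_ne_zero _ hne0)
    rw [CharP.cast_eq_zero_iff (O ⧸ I) 2] at hq'
    exact (Nat.not_even_iff_odd.2 hq) (even_iff_two_dvd.2 hq')
  intro h0
  apply permanent_ne_zero_of_charP_two hβinj
  have h0' : ∑ σ : Perm (Fin n), ∏ i, β i ^ (σ i : ℕ) = 0 := by
    apply Subtype.ext
    rw [← ZeroMemClass.coe_zero O, Matrix.permanent] at h0
    push_cast
    exact h0
  have := congrArg π h0'
  simpa only [map_sum, map_prod, map_pow, map_zero, Matrix.permanent, powMatrix,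
    Matrix.of_apply] using this

/-! ### The semigroup D(q) -/

theorem zero_mem_D (q : ℕ) : 0 ∈ D q := ⟨0, by simp⟩

theorem add_mem_D {q a b : ℕ} (ha : a ∈ D q) (hb : b ∈ D q) : a + b ∈ D q := by
  obtain ⟨x, rfl⟩ := ha
  obtain ⟨y, rfl⟩ := hb
  exact ⟨x + y, by simp [mul_add, sum_add_distrib]⟩

theorem sum_mem_D {q : ℕ} {ι : Type*} (s : Finset ι) {f : ι → ℕ} (h : ∀ i ∈ s, f i ∈ D q) :
    ∑ i ∈ s, f i ∈ D q :=
  sum_induction f (· ∈ D q) (fun _ _ => add_mem_D) (zero_mem_D q) h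

theorem mul_mem_D {q p : ℕ} (hp : p ∈ q.primeFactors) (a : ℕ) : p * a ∈ D q :=
  ⟨Pi.single p a, by
    rw [sum_eq_single p (fun b _ hb => by simp [hb]) (fun h => absurd hp h), Pi.single_eq_same]⟩

theorem D_mono {m q : ℕ} (hq : q ≠ 0) (h : m ∣ q) : D m ⊆ D q := by
  rintro _ ⟨x, rfl⟩
  exact sum_mem_D _ fun p hp => mul_mem_D (Nat.primeFactors_mono h hq hp) _

/-- The bound exceeds the Frobenius number pp' - p - p' of the two primes. -/
theorem mem_D_of_frobenius {q p p' N : ℕ} (hp : p ∈ q.primeFactors) (hp' : p' ∈ q.primeFactors)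
    (hne : p ≠ p') (hN : p * (p' - 1) ≤ N) : N ∈ D q := by
  have h1 := Nat.prime_of_mem_primeFactors hp
  have h2 := Nat.prime_of_mem_primeFactors hp'
  have hfrob := frobeniusNumber_pair ((Nat.coprime_primes h1 h2).2 hne) h1.one_lt h2.one_lt
  have hmem : N ∈ AddSubmonoid.closure {p, p'} := by
    refine (frobeniusNumber_iff.1 hfrob).2 N (lt_of_lt_of_le ?_ hN)
    rw [Nat.mul_sub, mul_one]
    have : p + p' ≤ p * p' := by nlinarith [h1.two_le, h2.two_le]
    have := h2.pos
    omega
  obtain ⟨a, b, rfl⟩ := (AddSubmonoid.mem_closure_pair _ _ _).1 hmem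
  rw [smul_eq_mul, smul_eq_mul, mul_comm a, mul_comm b]
  exact add_mem_D (mul_mem_D hp a) (mul_mem_D hp' b)

/-! ### Linear relations between roots of unity -/

/-- Galois invariance of the linear relations between roots of unity. -/
theorem sum_map_pow_eq {q k : ℕ} (hq : 0 < q) (hk : k.Coprime q) {u v : Multiset ℂ}
    (hu : ∀ x ∈ u, x ^ q = 1) (hv : ∀ x ∈ v, x ^ q = 1) (h : u.sum = v.sum) :
    (u.map (· ^ k)).sum = (v.map (· ^ k)).sum := by
  have hq0 : NeZero q := ⟨hq.ne'⟩
  have hζ := Complex.isPrimitiveRoot_exp q hq.ne'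
  set ζ := Complex.exp (2 * Real.pi * Complex.I / q)
  have hex : ∀ x : ℂ, ∃ e : ℕ, x ^ q = 1 → ζ ^ e = x := fun x => by
    by_cases hx : x ^ q = 1
    · obtain ⟨e, -, he⟩ := hζ.eq_pow_of_pow_eq_one hx
      exact ⟨e, fun _ => he⟩
    · exact ⟨0, fun h => absurd h hx⟩
  choose e he using hex
  let f : Multiset ℂ → ℤ[X] := fun w => (w.map fun x => X ^ e x).sum
  have hf : ∀ (j : ℕ) (w : Multiset ℂ), (∀ x ∈ w, x ^ q = 1) →
      aeval (ζ ^ j) (f w) = (w.map (· ^ j)).sum := by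
    intro j w hw
    rw [map_multiset_sum, Multiset.map_map]
    congr 1
    refine Multiset.map_congr rfl fun x hx => ?_
    rw [Function.comp_apply, map_pow, aeval_X, ← pow_mul, mul_comm, pow_mul, he x (hw x hx)]
  have h1 : aeval ζ (f u - f v) = 0 := by
    have hu1 := hf 1 u hu
    have hv1 := hf 1 v hv
    simp only [pow_one, Multiset.map_id'] at hu1 hv1
    rw [map_sub, hu1, hv1, h, sub_self]
  obtain ⟨g, hg⟩ := minpoly.isIntegrallyClosed_dvd (hζ.isIntegral hq) h1
  have h2 : aeval (ζ ^ k) (f u - f v) = 0 := by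
    rw [hg, hζ.minpoly_eq_pow_coprime hk, map_mul, minpoly.aeval, zero_mul]
  rwa [map_sub, hf k u hu, hf k v hv, sub_eq_zero] at h2

open Classical in
/-- The elements `y` with `y ^ m = 1` such that `s ^ i * y ∈ u`. -/
noncomputable def cosetPart (m : ℕ) (s : ℂ) (u : Multiset ℂ) (i : ℕ) : Multiset ℂ :=
  (u.filter fun x => x ^ m = (s ^ m) ^ i).map fun x => x * (s ^ i)⁻¹

theorem cosetPart_pow_eq_one {m : ℕ} {s : ℂ} (hs : s ≠ 0) {u : Multiset ℂ} {i : ℕ} :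
    ∀ y ∈ cosetPart m s u i, y ^ m = 1 := by
  intro y hy
  obtain ⟨x, hx, rfl⟩ := Multiset.mem_map.1 hy
  rw [mul_pow, (Multiset.mem_filter.1 hx).2, inv_pow, pow_right_comm,
    mul_inv_cancel₀ (pow_ne_zero _ (pow_ne_zero _ hs))]

theorem sum_map_cosetPart {M : Type*} [AddCommMonoid M] {p m : ℕ} (hp : 0 < p) {s : ℂ}
    (hs : s ≠ 0) (hω : IsPrimitiveRoot (s ^ m) p) (g : ℂ → M) {u : Multiset ℂ}
    (hu : ∀ x ∈ u, x ^ (p * m) = 1) :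
    (u.map g).sum = ∑ i : Fin p, ((cosetPart m s u i).map fun y => g (s ^ (i : ℕ) * y)).sum := by
  classical
  have hpart : ∀ i : Fin p, ((cosetPart m s u i).map fun y => g (s ^ (i : ℕ) * y)) =
      (u.filter fun x => x ^ m = (s ^ m) ^ (i : ℕ)).map g := fun i => by
    rw [cosetPart, Multiset.map_map]
    refine Multiset.map_congr (by congr) fun x _ => ?_
    rw [Function.comp_apply, mul_comm x, mul_inv_cancel_left₀ (pow_ne_zero _ hs)]
  simp only [hpart]
  induction u using Multiset.induction_on with
  | empty => simp
  | cons a u ih =>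
    have ha : (a ^ m) ^ p = 1 := by
      rw [← pow_mul, mul_comm m p]
      exact hu a (Multiset.mem_cons_self a u)
    have : NeZero p := ⟨hp.ne'⟩
    obtain ⟨i, hi, hia⟩ := hω.eq_pow_of_pow_eq_one ha
    have hadd : ∀ j : Fin p, (((a ::ₘ u).filter fun x => x ^ m = (s ^ m) ^ (j : ℕ)).map g).sum =
        (if j = ⟨i, hi⟩ then g a else 0) +
          ((u.filter fun x => x ^ m = (s ^ m) ^ (j : ℕ)).map g).sum := by
      intro j
      by_cases hj : j = ⟨i, hi⟩
      · subst hj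
        rw [if_pos rfl, Multiset.filter_cons_of_pos (p := fun x => x ^ m = (s ^ m) ^ i) _ hia.symm,
          Multiset.map_cons, Multiset.sum_cons]
      · rw [if_neg hj, zero_add, Multiset.filter_cons_of_neg]
        intro h
        exact hj (Fin.ext (hω.pow_inj j.2 hi (by rw [← h, hia])))
    simp only [hadd, sum_add_distrib, Multiset.map_cons, Multiset.sum_cons]
    rw [sum_ite_eq' univ, if_pos (mem_univ _), ih (fun x hx => hu x (Multiset.mem_cons_of_mem hx))]
    intro j
    rw [cosetPart, Multiset.map_map]
    refine Multiset.map_congr (by congr) fun x _ => ?_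
    rw [Function.comp_apply, mul_comm x, mul_inv_cancel_left₀ (pow_ne_zero _ hs)]

theorem card_eq_sum_card_cosetPart {p m : ℕ} (hp : 0 < p) {s : ℂ}
    (hs : s ≠ 0) (hω : IsPrimitiveRoot (s ^ m) p) {u : Multiset ℂ}
    (hu : ∀ x ∈ u, x ^ (p * m) = 1) :
    u.card = ∑ i : Fin p, (cosetPart m s u i).card := by
  simpa only [Multiset.map_const', Multiset.sum_replicate, smul_eq_mul, mul_one] using
    sum_map_cosetPart hp hs hω (fun _ => (1 : ℕ)) hu

/-- Raising roots of unity to the power k preserves the relation. As k ≡ 1 mod m, it fixes the m-th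
roots of unity and only moves the representatives s^i. -/
theorem sum_pow_mul_cosetPart {p m k : ℕ} (hp : 0 < p) {s : ℂ}
    (hs : s ≠ 0) (hω : IsPrimitiveRoot (s ^ m) p) (hk : k.Coprime (p * m)) (hm : 0 < m)
    (hkm : k ≡ 1 [MOD m]) {u v : Multiset ℂ} (hu : ∀ x ∈ u, x ^ (p * m) = 1)
    (hv : ∀ x ∈ v, x ^ (p * m) = 1) (h : u.sum = v.sum) :
    ∑ i : Fin p, (s ^ k) ^ (i : ℕ) * ((cosetPart m s u i).sum - (cosetPart m s v i).sum) = 0 := by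
  have key : ∀ w : Multiset ℂ, (∀ x ∈ w, x ^ (p * m) = 1) → (w.map (· ^ k)).sum =
      ∑ i : Fin p, (s ^ k) ^ (i : ℕ) * (cosetPart m s w i).sum := by
    intro w hw
    rw [sum_map_cosetPart hp hs hω _ hw]
    refine sum_congr rfl fun i _ => ?_
    conv_rhs => rw [← Multiset.map_id' (cosetPart m s w i), ← Multiset.sum_map_mul_left]
    congr 1
    refine Multiset.map_congr rfl fun y hy => ?_
    have hy1 := cosetPart_pow_eq_one hs y hy
    have : y ^ k = y ^ 1 := pow_eq_pow_of_modEq hkm hy1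
    rw [mul_pow, this, pow_one, pow_right_comm]
  have := sum_map_pow_eq (Nat.mul_pos hp hm) hk hu hv h
  rw [key u hu, key v hv] at this
  simp only [mul_sub, sum_sub_distrib]
  rw [this, sub_self]

/-- If the prime `p` divides `m`, then a linear relation between `p * m`-th roots of unity is the
sum of the relations between the elements of each coset of the `m`-th roots of unity. -/
theorem sum_cosetPart_eq_of_dvd {p m : ℕ} (hp : p.Prime) (hm : 0 < m) (hpm : p ∣ m) {s : ℂ}
    (hs : s ≠ 0) (hω : IsPrimitiveRoot (s ^ m) p) {u v : Multiset ℂ}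
    (hu : ∀ x ∈ u, x ^ (p * m) = 1) (hv : ∀ x ∈ v, x ^ (p * m) = 1) (h : u.sum = v.sum)
    (i : Fin p) : (cosetPart m s u i).sum = (cosetPart m s v i).sum := by
  have hinj : Function.Injective fun j : Fin p => (s ^ m) ^ (j : ℕ) :=
    fun a b hab => Fin.ext (hω.pow_inj a.2 b.2 hab)
  have := Matrix.eq_zero_of_forall_index_sum_pow_mul_eq_zero hinj (v := fun i : Fin p =>
    s ^ (i : ℕ) * ((cosetPart m s u i).sum - (cosetPart m s v i).sum)) (fun j => by
      -- With k = 1 + mj, s^k is s times the j-th power of the primitive p-th root s^m; the p values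
      -- of j give an invertible Vandermonde system.
      have hcop : (1 + m * j).Coprime m := by simp
      have hk : (1 + m * j).Coprime (p * m) :=
        Nat.Coprime.mul_right (hcop.coprime_dvd_right hpm) hcop
      rw [← sum_pow_mul_cosetPart hp.pos hs hω hk hm (by simp [Nat.ModEq]) hu hv h]
      refine sum_congr rfl fun i _ => ?_
      rw [← mul_assoc, pow_add, pow_one, mul_pow, pow_mul, mul_comm (s ^ (i : ℕ))])
  have := congrFun this i
  simp only [Pi.zero_apply] at this
  exact sub_eq_zero.1 ((mul_eq_zero.1 this).resolve_left (pow_ne_zero _ hs))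

/-- Constant vectors satisfy these equations, so the last entry can be subtracted; the p - 1
equations then form an invertible Vandermonde system in the other entries. -/
theorem eq_of_forall_sum_pow_mul_eq_zero {p : ℕ} {s : ℂ} (hs : IsPrimitiveRoot s p)
    (c : Fin p → ℂ) (h : ∀ j : ℕ, 0 < j → j < p → ∑ i : Fin p, (s ^ j) ^ (i : ℕ) * c i = 0)
    (i i' : Fin p) : c i = c i' := by
  obtain _ | N := p
  · exact i.elim0
  have hinj : Function.Injective fun j : Fin N => s ^ ((j : ℕ) + 1) := fun a b hab => by
    have := hs.pow_inj (by omega) (by omega) hab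
    exact Fin.ext (by omega)
  have hlast := Matrix.eq_zero_of_forall_index_sum_pow_mul_eq_zero hinj
    (v := fun i : Fin N => c i.castSucc - c (Fin.last N)) (fun j => by
      have h1 := h (j + 1) (by omega) (by omega)
      have h2 : ∑ i : Fin (N + 1), (s ^ ((j : ℕ) + 1)) ^ (i : ℕ) = 0 := by
        rw [Fin.sum_univ_eq_sum_range (fun i => (s ^ ((j : ℕ) + 1)) ^ i)]
        have hne : s ^ ((j : ℕ) + 1) ≠ 1 := hs.pow_ne_one_of_pos_of_lt (by omega) (by omega)
        have h3 := mul_geom_sum (s ^ ((j : ℕ) + 1)) (N + 1)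
        rw [pow_right_comm, hs.pow_eq_one, one_pow, sub_self] at h3
        exact (mul_eq_zero.1 h3).resolve_left (sub_ne_zero.2 hne)
      rw [Fin.sum_univ_castSucc] at h1 h2
      simp only [Fin.val_castSucc] at h1 h2
      simp only [mul_sub, sum_sub_distrib, ← sum_mul]
      linear_combination h1 - c (Fin.last N) * h2)
  have hall : ∀ i : Fin (N + 1), c i = c (Fin.last N) := fun i => by
    induction i using Fin.lastCases with
    | last => rfl
    | cast i => exact sub_eq_zero.1 (congrFun hlast i)
  rw [hall i, hall i']

theorem sum_cosetPart_add_eq_of_not_dvd {p m : ℕ} (hp : p.Prime) (hm : 0 < m) (hpm : ¬ p ∣ m)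
    {s : ℂ} (hs : IsPrimitiveRoot s p) {u v : Multiset ℂ}
    (hu : ∀ x ∈ u, x ^ (p * m) = 1) (hv : ∀ x ∈ v, x ^ (p * m) = 1) (h : u.sum = v.sum)
    (i i' : Fin p) : (cosetPart m s u i).sum - (cosetPart m s v i).sum =
      (cosetPart m s u i').sum - (cosetPart m s v i').sum := by
  have hcop : p.Coprime m := (Nat.Prime.coprime_iff_not_dvd hp).2 hpm
  refine eq_of_forall_sum_pow_mul_eq_zero hs
    (fun i => (cosetPart m s u i).sum - (cosetPart m s v i).sum) (fun j hj hjp => ?_) i i'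
  obtain ⟨k, hkp, hkm⟩ := Nat.chineseRemainder hcop j 1
  have hk1 : k.Coprime p := by
    rw [Nat.coprime_iff_gcd_eq_one, hkp.gcd_eq]
    exact (Nat.coprime_of_lt_prime hj.ne' hjp hp).symm
  have hk2 : k.Coprime m := by
    rw [Nat.coprime_iff_gcd_eq_one, hkm.gcd_eq, Nat.gcd_one_left]
  have := sum_pow_mul_cosetPart hp.pos (hs.ne_zero hp.ne_zero) (hs.pow_of_coprime m hcop.symm)
    (Nat.Coprime.mul_right hk1 hk2) hm hkm hu hv h
  rwa [pow_eq_pow_of_modEq hkp hs.pow_eq_one] at this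

/-! ### The Lam–Leung theorem -/

theorem sum_eq_card_of_pow_one {u : Multiset ℂ} (hu : ∀ x ∈ u, x ^ 1 = 1) : u.sum = u.card := by
  have : u = Multiset.replicate u.card 1 :=
    Multiset.eq_replicate_card.2 fun x hx => by rw [← pow_one x, hu x hx]
  rw [this]
  simp

/-- This keeps the length bounds alive in the induction. For one coset, w and U' count its elements
in v and u, x counts the rest of v, z counts other cosets missed by v, and a is the least size of
the u-part over the cosets missed by v. -/
theorem cosetPart_bound {w x a z U U' p₁ p₂ : ℕ} (hV : w + x < p₁) (h12 : p₁ < p₂)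
    (hz : p₂ ≤ z + x + 1) (hU : U' + a * z ≤ U) (hlt : U < (p₁ - (w + x)) * (p₂ - 1)) :
    w + a < p₁ ∧ U' < (p₁ - (w + a)) * (p₂ - 1) := by
  obtain ⟨r, rfl⟩ := Nat.exists_eq_add_of_lt hV
  obtain ⟨Q, rfl⟩ : ∃ Q, p₂ = Q + 1 := ⟨p₂ - 1, by omega⟩
  have e1 : w + x + r + 1 - (w + x) = r + 1 := by omega
  rw [e1, Nat.add_sub_cancel] at hlt
  rw [Nat.add_sub_cancel]
  have hz' : Q ≤ z + x := by omega
  have hwa : w + a < w + x + r + 1 := by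
    by_contra! hcon
    obtain ⟨t, ht⟩ : ∃ t, a = x + r + 1 + t := ⟨a - (x + r + 1), by omega⟩
    subst ht
    nlinarith
  refine ⟨hwa, ?_⟩
  obtain ⟨t, ht⟩ : ∃ t, x + r + 1 = a + t := ⟨x + r + 1 - a, by omega⟩
  have e2 : w + x + r + 1 - (w + a) = t := by omega
  rw [e2]
  by_contra! hcon
  nlinarith

/-- If the prime divisors of `q` are at least `p₂`, except possibly for `p₁ < p₂`, then the numbers
of summands of two equal sums of `q`-th roots of unity differ by an element of `D q`, provided
that both sums are short. -/
theorem exists_card_eq_card_add_of_sum_eq {p₁ p₂ : ℕ} (h12 : p₁ < p₂) (q : ℕ) (hq : 0 < q)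
    (hprime : ∀ p, p.Prime → p ∣ q → p = p₁ ∨ p₂ ≤ p) (u v : Multiset ℂ)
    (hu : ∀ x ∈ u, x ^ q = 1) (hv : ∀ x ∈ v, x ^ q = 1) (h : u.sum = v.sum)
    (hv1 : v.card < p₁) (hu1 : u.card < (p₁ - v.card) * (p₂ - 1)) :
    ∃ d ∈ D q, u.card = v.card + d := by
  induction q using Nat.strong_induction_on generalizing u v with
  | _ q ih =>
  by_cases hq1 : q = 1
  · subst hq1
    rw [sum_eq_card_of_pow_one hu, sum_eq_card_of_pow_one hv] at h
    exact ⟨0, zero_mem_D 1, by exact_mod_cast h⟩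
  -- The prime p₁ is split off only when no other is left: the counting for p ∤ m needs p ≥ p₂.
  obtain ⟨p, hp, hpq, hpp⟩ : ∃ p, p.Prime ∧ p ∣ q ∧
      (p₂ ≤ p ∨ p = p₁ ∧ ∀ p', p'.Prime → p' ∣ q → p' = p₁) := by
    by_cases hex : ∃ p, p.Prime ∧ p ∣ q ∧ p₂ ≤ p
    · obtain ⟨p, h1, h2, h3⟩ := hex
      exact ⟨p, h1, h2, Or.inl h3⟩
    · push Not at hex
      have hall : ∀ p', p'.Prime → p' ∣ q → p' = p₁ := fun p' h1 h2 =>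
        (hprime p' h1 h2).resolve_right (hex p' h1 h2).not_ge
      exact ⟨q.minFac, Nat.minFac_prime hq1, Nat.minFac_dvd q, Or.inr
        ⟨hall _ (Nat.minFac_prime hq1) (Nat.minFac_dvd q), hall⟩⟩
  obtain ⟨m, rfl⟩ := hpq
  have hm : 0 < m := Nat.pos_of_mul_pos_left hq
  have hmq : m < p * m := lt_mul_of_one_lt_left hm hp.one_lt
  have hDm : D m ⊆ D (p * m) := D_mono hq.ne' (Nat.dvd_mul_left m p)
  replace ih := ih m hmq hm fun p' hp' hd => hprime p' hp' (hd.mul_left p)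
  by_cases hpm : p ∣ m
  · obtain ⟨s, hs⟩ : ∃ s : ℂ, IsPrimitiveRoot s (p * m) :=
      ⟨_, Complex.isPrimitiveRoot_exp _ hq.ne'⟩
    have hs0 : s ≠ 0 := hs.ne_zero hq.ne'
    have hω : IsPrimitiveRoot (s ^ m) p := hs.pow hq (mul_comm p m)
    have hcu := card_eq_sum_card_cosetPart hp.pos hs0 hω hu
    have hcv := card_eq_sum_card_cosetPart hp.pos hs0 hω hv
    have hex : ∀ i : Fin p, ∃ d ∈ D m,
        (cosetPart m s u i).card = (cosetPart m s v i).card + d := fun i => by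
      have hle : (cosetPart m s u i).card ≤ u.card := by
        rw [hcu]
        exact single_le_sum (f := fun i : Fin p => (cosetPart m s u i).card)
          (fun _ _ => Nat.zero_le _) (mem_univ i)
      have hle' : (cosetPart m s v i).card ≤ v.card := by
        rw [hcv]
        exact single_le_sum (f := fun i : Fin p => (cosetPart m s v i).card)
          (fun _ _ => Nat.zero_le _) (mem_univ i)
      refine ih _ _ (cosetPart_pow_eq_one hs0) (cosetPart_pow_eq_one hs0)
        (sum_cosetPart_eq_of_dvd hp hm hpm hs0 hω hu hv h i) (hle'.trans_lt hv1)
        (hle.trans_lt (hu1.trans_le (Nat.mul_le_mul_right _ (by omega))))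
    choose d hd hde using hex
    refine ⟨∑ i, d i, sum_mem_D _ fun i _ => hDm (hd i), ?_⟩
    rw [hcu, hcv, ← sum_add_distrib]
    exact sum_congr rfl fun i _ => hde i
  · obtain ⟨s, hs⟩ : ∃ s : ℂ, IsPrimitiveRoot s p := ⟨_, Complex.isPrimitiveRoot_exp _ hp.ne_zero⟩
    have hs0 : s ≠ 0 := hs.ne_zero hp.ne_zero
    have hω : IsPrimitiveRoot (s ^ m) p :=
      hs.pow_of_coprime m ((Nat.Prime.coprime_iff_not_dvd hp).2 hpm).symm
    have hcu := card_eq_sum_card_cosetPart hp.pos hs0 hω hu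
    have hcv := card_eq_sum_card_cosetPart hp.pos hs0 hω hv
    let Z : Finset (Fin p) := univ.filter fun i => (cosetPart m s v i).card = 0
    have hcompl : ∀ S : Finset (Fin p), S.card ≤ (S ∩ Z).card +
        ∑ i ∈ S, (cosetPart m s v i).card := by
      intro S
      have h1 : (S \ Z).card ≤ ∑ i ∈ S \ Z, (cosetPart m s v i).card := by
        rw [card_eq_sum_ones]
        refine sum_le_sum fun i hi => Nat.one_le_iff_ne_zero.2 fun h0 => ?_
        exact (mem_sdiff.1 hi).2 (mem_filter.2 ⟨mem_univ i, h0⟩)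
      have h2 : ∑ i ∈ S \ Z, (cosetPart m s v i).card ≤ ∑ i ∈ S, (cosetPart m s v i).card :=
        sum_le_sum_of_subset sdiff_subset
      have h3 := card_inter_add_card_sdiff S Z
      omega
    have hpv : v.card < p := by
      rcases hpp with hpp | ⟨hpp, -⟩ <;> omega
    have hZ : Z.Nonempty := by
      rw [← card_pos]
      have := hcompl univ
      rw [card_univ, Fintype.card_fin, ← hcv, univ_inter] at this
      omega
    -- All differences of coset sums agree. Taking a coset missed by v turns their common value into
    -- a genuine sum, that of the u-part at i₀, which can be added to each v-part; minimality keeps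
    -- the new sums short.
    obtain ⟨i₀, hi₀, hmin⟩ := exists_min_image Z (fun i => (cosetPart m s u i).card) hZ
    have hv0 : cosetPart m s v i₀ = 0 := Multiset.card_eq_zero.1 (mem_filter.1 hi₀).2
    have hsum : ∀ i : Fin p, (cosetPart m s u i).sum =
        (cosetPart m s v i + cosetPart m s u i₀).sum := fun i => by
      have := sum_cosetPart_add_eq_of_not_dvd hp hm hpm hs hu hv h i i₀
      rw [hv0, Multiset.sum_zero, sub_zero, sub_eq_iff_eq_add] at this
      rw [this, Multiset.sum_add, add_comm]
    have hex : ∀ i : Fin p, ∃ d ∈ D m, (cosetPart m s u i).card =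
        (cosetPart m s v i + cosetPart m s u i₀).card + d := fun i => by
      have hroot : ∀ x ∈ cosetPart m s v i + cosetPart m s u i₀, x ^ m = 1 := fun x hx =>
        (Multiset.mem_add.1 hx).elim (cosetPart_pow_eq_one hs0 x) (cosetPart_pow_eq_one hs0 x)
      rcases hpp with hpp | ⟨rfl, hall⟩
      · have hxv := add_sum_erase univ (fun i : Fin p => (cosetPart m s v i).card) (mem_univ i)
        have hxu := add_sum_erase univ (fun i : Fin p => (cosetPart m s u i).card) (mem_univ i)
        rw [← hcv] at hxv
        rw [← hcu] at hxu
        have hz := hcompl (univ.erase i)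
        rw [card_erase_of_mem (mem_univ i), card_univ, Fintype.card_fin] at hz
        have hlow : (cosetPart m s u i₀).card * (univ.erase i ∩ Z).card ≤
            ∑ j ∈ univ.erase i, (cosetPart m s u j).card := by
          rw [mul_comm, ← smul_eq_mul]
          exact (card_nsmul_le_sum _ _ _ fun j hj => hmin j (mem_inter.1 hj).2).trans
            (sum_le_sum_of_subset inter_subset_left)
        have hb := cosetPart_bound (w := (cosetPart m s v i).card)
          (x := ∑ j ∈ univ.erase i, (cosetPart m s v j).card) (a := (cosetPart m s u i₀).card)
          (z := (univ.erase i ∩ Z).card) (U := u.card) (U' := (cosetPart m s u i).card)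
          (p₁ := p₁) (p₂ := p₂) (by omega) h12 (by omega) (by omega) (by rw [hxv]; exact hu1)
        refine ih _ _ (cosetPart_pow_eq_one hs0) hroot (hsum i) ?_ ?_
        · rw [Multiset.card_add]
          exact hb.1
        · rw [Multiset.card_add]
          exact hb.2
      · have hm1 : m = 1 := by
          by_contra hm1
          have := hall _ (Nat.minFac_prime hm1) ((Nat.minFac_dvd m).mul_left p)
          exact hpm (this ▸ Nat.minFac_dvd m)
        subst hm1
        have := hsum i
        rw [sum_eq_card_of_pow_one (cosetPart_pow_eq_one hs0), sum_eq_card_of_pow_one hroot] at this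
        exact ⟨0, zero_mem_D _, by exact_mod_cast this⟩
    choose d hd hde using hex
    refine ⟨p * (cosetPart m s u i₀).card + ∑ i, d i, add_mem_D (mul_mem_D
      (Nat.mem_primeFactors.2 ⟨hp, Nat.dvd_mul_right p m, hq.ne'⟩) _)
      (sum_mem_D _ fun i _ => hDm (hd i)), ?_⟩
    rw [hcu, hcv, sum_congr rfl fun i _ => hde i]
    simp only [Multiset.card_add, sum_add_distrib, sum_const, card_univ, Fintype.card_fin,
      smul_eq_mul]
    ring

/-- The Lam–Leung theorem on the lengths of vanishing sums of roots of unity. -/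
theorem card_mem_D_of_sum_eq_zero {q : ℕ} (hq : 0 < q) {u : Multiset ℂ}
    (hu : ∀ x ∈ u, x ^ q = 1) (h : u.sum = 0) : u.card ∈ D q := by
  by_cases hq1 : q = 1
  · subst hq1
    rw [sum_eq_card_of_pow_one hu, Nat.cast_eq_zero] at h
    rw [h]
    exact zero_mem_D 1
  have hp₁ := Nat.minFac_prime hq1
  have key : ∀ p₂, q.minFac < p₂ → (∀ p, p.Prime → p ∣ q → p = q.minFac ∨ p₂ ≤ p) →
      u.card < q.minFac * (p₂ - 1) → u.card ∈ D q := fun p₂ h12 hprime hlt => by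
    obtain ⟨d, hd, hde⟩ := exists_card_eq_card_add_of_sum_eq h12 q hq hprime u 0 hu (by simp)
      (by simpa using h) (by simpa using hp₁.pos) (by simpa using hlt)
    rw [Multiset.card_zero, zero_add] at hde
    rwa [hde]
  by_cases hex : ∃ p, p.Prime ∧ p ∣ q ∧ p ≠ q.minFac
  · classical
    obtain ⟨h1, h2, h3⟩ := Nat.find_spec hex
    by_cases hlt : u.card < q.minFac * (Nat.find hex - 1)
    · refine key _ (lt_of_le_of_ne (Nat.minFac_le_of_dvd h1.two_le h2) h3.symm)
        (fun p hp hpq => ?_) hlt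
      by_cases hpne : p = q.minFac
      · exact Or.inl hpne
      · exact Or.inr (Nat.find_min' hex ⟨hp, hpq, hpne⟩)
    · exact mem_D_of_frobenius (Nat.mem_primeFactors.2 ⟨hp₁, Nat.minFac_dvd q, hq.ne'⟩)
        (Nat.mem_primeFactors.2 ⟨h1, h2, hq.ne'⟩) h3.symm (not_lt.1 hlt)
  · push Not at hex
    -- With a single prime divisor p₂ is unconstrained, so it is taken large enough for the length
    -- bound.
    refine key (q.minFac + u.card + 1) (by omega) (fun p hp hpq => Or.inl (hex p hp hpq)) ?_
    rw [Nat.add_sub_cancel]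
    nlinarith [hp₁.two_le]

theorem permanent_ne_zero_of_factorial_notMem_D {q n : ℕ} (hq : 0 < q) {b : Fin n → ℂ}
    (hb : ∀ i, b i ^ q = 1) (hn : n.factorial ∉ D q) : (powMatrix b).permanent ≠ 0 := by
  intro h0
  apply hn
  have := card_mem_D_of_sum_eq_zero hq
    (u := (univ : Finset (Perm (Fin n))).val.map fun σ => ∏ i, b i ^ (σ i : ℕ)) (fun x hx => by
      obtain ⟨σ, -, rfl⟩ := Multiset.mem_map.1 hx
      rw [← prod_pow]
      exact prod_eq_one fun i _ => by rw [pow_right_comm, hb i, one_pow])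
    (by simpa [powMatrix, Matrix.permanent] using h0)
  rwa [Multiset.card_map, card_val, card_univ, Fintype.card_perm, Fintype.card_fin] at this

end SunSumset

theorem theorem1p4 (n m k : ℕ) (hm : 0 < m) (hk : (m : ℤ) * ((n : ℤ) - 1) < k) :
    (∀ (F : Type*) [Field F] (b : Fin n → F) (c : Fin n → Fin n → F)
        (P : Fin n → Polynomial F) (A : Fin n → Finset F),
        (∀ i, (P i).Monic) → (∀ i, (P i).natDegree = m) → (∀ i, (A i).card = k) →
        -- part (i)
        (((SunSumset.L k m n : ℤ) : WithTop ℤ) < SunSumset.ch F →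
          (SunSumset.powMatrix b).permanent ≠ 0 →
          SunSumset.L k m n < ((SunSumset.restrictedSums A P b c).ncard : ℤ) ∧
          ((m : ℤ) - 1) * (n.choose 2 : ℤ) ≤ SunSumset.L k m n) ∧
        -- part (ii)
        (SunSumset.ch F = 2 → m = 1 → k = n + 1 → Function.Injective b →
          n + 1 ≤ (SunSumset.restrictedSums A P b c).ncard)) ∧
    -- part (iii)
    (∀ (b : Fin n → ℂ) (c : Fin n → Fin n → ℂ)
        (P : Fin n → Polynomial ℂ) (A : Fin n → Finset ℂ),
        (∀ i, (P i).Monic) → (∀ i, (P i).natDegree = m) → (∀ i, (A i).card = k) →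
        ∀ q : ℕ, 0 < q → (∀ i, b i ^ q = 1) →
          (n.factorial ∉ SunSumset.D q ∨ (Odd q ∧ Function.Injective b)) →
          SunSumset.L k m n + 1 ≤ ((SunSumset.restrictedSums A P b c).ncard : ℤ)) := by
  refine ⟨fun F _ b c P A hP hPm hA => ⟨fun hch hper => ⟨?_, SunSumset.le_L hk⟩, ?_⟩, ?_⟩
  · exact SunSumset.L_lt_ncard_restrictedSums hm hk b c P A hP hPm hA
      (SunSumset.alternatingMultinomial_ne_zero hm hk
        (SunSumset.factorial_ne_zero_of_lt_ch hch)) hper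
  · rintro hch rfl rfl hb
    have := SunSumset.charP_two_of_ch_eq_two hch
    have hZ : (SunSumset.alternatingMultinomial n 1 (n + 1 - 1) : F) ≠ 0 := by
      rw [Nat.add_sub_cancel]
      rcases Int.natAbs_eq_iff.1 (SunSumset.alternatingMultinomial_natAbs_one n) with h | h <;>
        simp [h]
    have hlt := SunSumset.L_lt_ncard_restrictedSums hm hk b c P A hP hPm hA hZ
      (SunSumset.permanent_ne_zero_of_charP_two hb)
    -- Here L = n · n - 2 (n choose 2) = n, so the strict bound gives n + 1.
    have hL : SunSumset.L (n + 1) 1 n = n := by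
      have h1 := SunSumset.toNat_L_add hm hk
      have h2 := SunSumset.add_two_mul_choose_two n
      have h3 := SunSumset.L_nonneg hm hk
      rw [Nat.add_sub_cancel] at h1
      omega
    rw [hL] at hlt
    exact_mod_cast hlt
  · intro b c P A hP hPm hA q hq hb hor
    have hper : (SunSumset.powMatrix b).permanent ≠ 0 := by
      rcases hor with hn | ⟨hodd, hinj⟩
      · exact SunSumset.permanent_ne_zero_of_factorial_notMem_D hq hb hn
      · exact SunSumset.permanent_ne_zero_of_odd hodd hb hinj
    exact SunSumset.L_lt_ncard_restrictedSums hm hk b c P A hP hPm hA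
      (SunSumset.alternatingMultinomial_ne_zero hm hk
        (by exact_mod_cast Nat.factorial_ne_zero _)) hper
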